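/- Let $a<b$, let $0<\alpha<1$, and let $B$ be a normalization function, that is, $B:[0,1]\to(0,\infty)$ with $B(0)=B(1)=1$. For $f\in H^1(a,b)$, with weak derivative $f'\in L^2(a,b)$, let $$({}^{ABC}{}_aD^\alpha f)(t)=\frac{B(\alpha)}{1-\alpha}\int_a^t E_\alpha\!\left[-\frac{\alpha}{1-\alpha}(t-s)^\alpha\right]f'(s)\,ds,\qquad t\in[a,b],$$ be the left Caputo fractional derivative with Mittag-Leffler non-singular kernel, where $E_\alpha(x)=\sum_{n=0}^\infty \frac{x^n}{\Gamma(\alpha n+1)}$ is the Mittag-Leffler function. Let $p,g_1,g_2$ be real-valued continuous functions on $[a,b]$ with $p(t)\ge 0$ for all $t\in[a,b]$ and $p(a)\ne 0$. Let $u_1,u_2\in H^1(a,b)\cap C[a,b]$ be real-valued and satisfy $$({}^{ABC}{}_aD^\alpha u_i)(t)+p(t)\,u_i(t)=g_i(t),\qquad a<t\le b,\quad i=1,2.$$ If $g_1(t)\le g_2(t)$ for all $t\in[a,b]$, then $u_1(t)\le u_2(t)$ for all $t\in[a,b]$. -/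

import Mathlib

open MeasureTheory Set
open scoped ContDiff

noncomputable section

/-- The (one-parameter) Mittag-Leffler function `E_α(x) = ∑ xⁿ / Γ(α n + 1)`. -/
def mittagLeffler (α x : ℝ) : ℝ :=
  ∑' n : ℕ, x ^ n / Real.Gamma (α * n + 1)

/-- `g` is a weak derivative of `f` on the open interval `(a, b)`: integration by parts holds
against every smooth function with compact support in `(a, b)`. -/
def IsWeakDeriv (a b : ℝ) (f g : ℝ → ℝ) : Prop :=
  ∀ φ : ℝ → ℝ, ContDiff ℝ ∞ φ → HasCompactSupport φ → tsupport φ ⊆ Ioo a b →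
    ∫ x in Ioo a b, f x * deriv φ x = -∫ x in Ioo a b, g x * φ x

/-- The Sobolev space `H¹(a, b)`: `f ∈ L²(a, b)` has a weak derivative in `L²(a, b)`. Only the
values of `f` on `(a, b)` matter. -/
def MemH1 (a b : ℝ) (f : ℝ → ℝ) : Prop :=
  MemLp f 2 (volume.restrict (Ioo a b)) ∧
    ∃ g : ℝ → ℝ, MemLp g 2 (volume.restrict (Ioo a b)) ∧ IsWeakDeriv a b f g

open Classical in
/-- The weak derivative in `L²(a, b)` of a function `f ∈ H¹(a, b)`; it is determined almost
everywhere on `(a, b)` (see `IsWeakDeriv.ae_eq`). It is `0` if `f ∉ H¹(a, b)`. -/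
def weakDeriv (a b : ℝ) (f : ℝ → ℝ) : ℝ → ℝ :=
  if h : MemH1 a b f then h.2.choose else 0

/-- The left Caputo fractional derivative of order `α` with Mittag-Leffler kernel, based at `a`,
with normalization function `B`, of a function `f ∈ H¹(a, b)`, at a point `t ∈ [a, b]`. -/
def abcDeriv (B : ℝ → ℝ) (a b α : ℝ) (f : ℝ → ℝ) (t : ℝ) : ℝ :=
  B α / (1 - α) *
    ∫ s in a..t, mittagLeffler α (-(α / (1 - α)) * (t - s) ^ α) * weakDeriv a b f s

/-- A normalization function: `B > 0` on `[0, 1]` and `B(0) = B(1) = 1`. -/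
structure IsNormalizationFunction (B : ℝ → ℝ) : Prop where
  pos : ∀ α ∈ Icc (0 : ℝ) 1, 0 < B α
  map_zero : B 0 = 1
  map_one : B 1 = 1

theorem MemH1.weakDeriv_spec {a b : ℝ} {f : ℝ → ℝ} (h : MemH1 a b f) :
    MemLp (weakDeriv a b f) 2 (volume.restrict (Ioo a b)) ∧
      IsWeakDeriv a b f (weakDeriv a b f) := by
  have := h.2.choose_spec
  simpa only [weakDeriv, dif_pos h] using this

/-- Square-integrable weak derivatives are unique almost everywhere. -/
theorem IsWeakDeriv.ae_eq {a b : ℝ} {f g₁ g₂ : ℝ → ℝ}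
    (hg₁ : MemLp g₁ 2 (volume.restrict (Ioo a b))) (hg₂ : MemLp g₂ 2 (volume.restrict (Ioo a b)))
    (h₁ : IsWeakDeriv a b f g₁) (h₂ : IsWeakDeriv a b f g₂) :
    g₁ =ᵐ[volume.restrict (Ioo a b)] g₂ := by
  have i₁ : IntegrableOn g₁ (Ioo a b) := hg₁.integrable (by norm_num)
  have i₂ : IntegrableOn g₂ (Ioo a b) := hg₂.integrable (by norm_num)
  have key : ∀ᵐ x, x ∈ Ioo a b → (g₁ - g₂) x = 0 := by
    refine isOpen_Ioo.ae_eq_zero_of_integral_contDiff_smul_eq_zero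
      (i₁.sub i₂).locallyIntegrableOn ?_
    intro φ hφ hc hs
    have bd : ∃ C, ∀ x, ‖φ x‖ ≤ C := hc.exists_bound_of_continuous hφ.continuous
    obtain ⟨C, hC⟩ := bd
    have m : AEStronglyMeasurable φ (volume.restrict (Ioo a b)) :=
      hφ.continuous.aestronglyMeasurable
    have j₁ : Integrable (fun x => g₁ x * φ x) (volume.restrict (Ioo a b)) :=
      Integrable.mul_bdd (c := C) i₁ m (Filter.Eventually.of_forall hC)
    have j₂ : Integrable (fun x => g₂ x * φ x) (volume.restrict (Ioo a b)) :=
      Integrable.mul_bdd (c := C) i₂ m (Filter.Eventually.of_forall hC)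
    have e : ∫ x, φ x • (g₁ - g₂) x = ∫ x in Ioo a b, (g₁ x * φ x - g₂ x * φ x) := by
      rw [← setIntegral_eq_integral_of_forall_compl_eq_zero (s := Ioo a b)]
      · refine integral_congr_ae (Filter.Eventually.of_forall fun x => ?_)
        simp only [Pi.sub_apply, smul_eq_mul]
        ring
      · intro x hx
        have : φ x = 0 := image_eq_zero_of_notMem_tsupport fun h => hx (hs h)
        simp [this]
    rw [e, integral_sub j₁ j₂]
    have := h₁ φ hφ hc hs
    have := h₂ φ hφ hc hs
    linarith
  refine (ae_restrict_iff' measurableSet_Ioo).2 ?_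
  filter_upwards [key] with x hx hxI
  have := hx hxI
  simpa [sub_eq_zero] using this

end

/-! Put v = u₂ - u₁ and l = α/(1-α). The kernel E_α(-l(t-s)^α) is bounded by 1, so the fractional
derivative of v tends to 0 as t → a⁺, and the equation leaves p(a)v(a) = g₂(a) - g₁(a) ≥ 0; since
p(a) > 0, v(a) ≥ 0. A negative minimum of v would thus sit at some t₀ > a. The kernel is positive
and nondecreasing in s, so integrating by parts against v - v(t₀) ≥ 0
(`integral_mul_le_of_primitive_ge`) makes the fractional derivative negative at t₀, while p(t₀)v(t₀)
≤ 0. This contradicts g₁ ≤ g₂.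

Two inputs carry this. First, E_α is positive and nondecreasing on (-∞, 0]. Complete monotonicity is
not needed: E_α(c s^α) solves a Caputo equation (`caputo_mittagLeffler`), and the power-kernel
Caputo derivative has its own minimum principle (`integral_rpow_mul_deriv_le_of_isMinOn`). Second, a
continuous H¹ function is a primitive of its weak derivative (`IsWeakDeriv.eq_add_integral`). -/

/-! ### The Mittag-Leffler series and its derivative -/

theorem Real.rpow_mul_exp_neg_le_Gamma_add_one {x M : ℝ} (hx : 0 ≤ x) (hM : 0 < M) :
    M ^ x * Real.exp (-(M + 1)) ≤ Real.Gamma (x + 1) := by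
  rw [Real.Gamma_eq_integral (by linarith)]
  have hint := Real.GammaIntegral_convergent (s := x + 1) (by linarith)
  -- Keep only the unit window (M, M+1] of the Gamma integral, where t^x ≥ M^x and e^(-t) ≥
  -- e^(-(M+1)).
  have h1 : ∫ t in Ioc M (M + 1), M ^ x * Real.exp (-(M + 1)) ≤
      ∫ t in Ioc M (M + 1), Real.exp (-t) * t ^ (x + 1 - 1) := by
    refine setIntegral_mono_on (integrableOn_const (by simp)) (hint.mono_set fun t ht => hM.trans ht.1)
      measurableSet_Ioc fun t ht => ?_
    have := Real.rpow_le_rpow hM.le ht.1.le hx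
    have h2 : Real.exp (-(M + 1)) ≤ Real.exp (-t) := Real.exp_le_exp.2 (by linarith [ht.2])
    rw [add_sub_cancel_right, mul_comm]
    gcongr
  have h2 : ∫ t in Ioc M (M + 1), Real.exp (-t) * t ^ (x + 1 - 1) ≤
      ∫ t in Ioi 0, Real.exp (-t) * t ^ (x + 1 - 1) := by
    refine setIntegral_mono_set hint ?_ ?_
    · filter_upwards [ae_restrict_mem measurableSet_Ioi] with t ht
      exact mul_nonneg (Real.exp_pos _).le (Real.rpow_nonneg (le_of_lt ht) _)
    · exact Filter.Eventually.of_forall fun t ht => hM.trans ht.1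
  simpa using h1.trans h2

theorem Real.summable_pow_div_Gamma {α : ℝ} (hα : 0 < α) (x : ℝ) :
    Summable fun n : ℕ => x ^ n / Real.Gamma (α * n + 1) := by
  -- Chosen so that M^(αn) = (2|x|+1)^n, which beats |x|^n by a factor 2^n.
  set M : ℝ := (2 * |x| + 1) ^ α⁻¹ with hMdef
  have hx0 : 0 < 2 * |x| + 1 := by positivity
  have hM : 0 < M := Real.rpow_pos_of_pos hx0 _
  have hMn (n : ℕ) : M ^ (α * n) = (2 * |x| + 1) ^ n := by
    rw [hMdef, ← Real.rpow_mul hx0.le, inv_mul_cancel_left₀ hα.ne', Real.rpow_natCast]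
  refine Summable.of_norm_bounded (g := fun n : ℕ => (1 / 2 : ℝ) ^ n * Real.exp (M + 1))
    ((summable_geometric_of_lt_one (by norm_num) (by norm_num)).mul_right _) fun n => ?_
  have h := Real.rpow_mul_exp_neg_le_Gamma_add_one (x := α * n) (by positivity) hM
  rw [hMn] at h
  have hG : 0 < Real.Gamma (α * n + 1) := Real.Gamma_pos_of_pos (by positivity)
  rw [norm_div, norm_pow, Real.norm_eq_abs, Real.norm_of_nonneg hG.le, div_le_iff₀ hG]
  calc |x| ^ n ≤ (1 / 2 * (2 * |x| + 1)) ^ n := by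
        gcongr; linarith
    _ = (1 / 2) ^ n * Real.exp (M + 1) * ((2 * |x| + 1) ^ n * Real.exp (-(M + 1))) := by
        rw [mul_pow, Real.exp_neg]; field_simp
    _ ≤ _ := by gcongr

theorem hasDerivAt_mittagLeffler {α : ℝ} (hα : 0 < α) (x : ℝ) :
    HasDerivAt (mittagLeffler α)
      (∑' n : ℕ, (n + 1) * x ^ n / Real.Gamma (α * (n + 1) + 1)) x := by
  set R : ℝ := |x| + 1
  have hR : 1 ≤ R := by simp [R]
  -- Since n ≤ 2^n and R ≥ 1, the differentiated series is dominated by the series of E_α at 2R.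
  have hsum : Summable fun n : ℕ => n * R ^ (n - 1) / Real.Gamma (α * n + 1) := by
    refine Summable.of_norm_bounded (Real.summable_pow_div_Gamma hα (2 * R)) fun n => ?_
    have hG : 0 < Real.Gamma (α * n + 1) := Real.Gamma_pos_of_pos (by positivity)
    rw [Real.norm_of_nonneg (by positivity), mul_pow]
    gcongr
    · exact_mod_cast Nat.lt_two_pow_self.le
    · omega
  have key := hasDerivAt_tsum_of_isPreconnected (t := Metric.ball (0 : ℝ) R)
    (g := fun (n : ℕ) x => x ^ n / Real.Gamma (α * n + 1))
    (g' := fun (n : ℕ) x => n * x ^ (n - 1) / Real.Gamma (α * n + 1)) (y₀ := x) (y := x)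
    hsum Metric.isOpen_ball (convex_ball _ _).isPreconnected
    (fun n y _ => (hasDerivAt_pow n y).div_const _) ?_ (by simp [R])
    (Real.summable_pow_div_Gamma hα x) (by simp [R])
  · convert! key using 1
    symm
    rw [tsum_eq_zero_add']
    · simp
    · refine ((summable_nat_add_iff 1).2 (hsum)).of_norm_bounded fun n => ?_
      have hG : 0 < Real.Gamma (α * (n + 1 : ℕ) + 1) := Real.Gamma_pos_of_pos (by positivity)
      rw [norm_div, norm_mul, norm_pow, Real.norm_of_nonneg hG.le, Real.norm_natCast]
      gcongr
      simp [R]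
  · intro n y hy
    have hG : 0 < Real.Gamma (α * n + 1) := Real.Gamma_pos_of_pos (by positivity)
    rw [norm_div, norm_mul, norm_pow, Real.norm_of_nonneg hG.le, Real.norm_natCast]
    gcongr
    simpa using (mem_ball_zero_iff.1 hy).le

theorem continuous_mittagLeffler {α : ℝ} (hα : 0 < α) : Continuous (mittagLeffler α) :=
  continuous_iff_continuousAt.2 fun x => (hasDerivAt_mittagLeffler hα x).continuousAt

theorem mittagLeffler_zero (α : ℝ) : mittagLeffler α 0 = 1 := by
  rw [mittagLeffler, tsum_eq_single 0]
  · simp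
  · intro n hn; simp [hn]

/-- The chain-rule factor α(n+1) is absorbed by Γ(z+1) = zΓ(z), leaving powers of s ready for Beta
integrals. -/
theorem hasDerivAt_mittagLeffler_rpow {α : ℝ} (hα : 0 < α) (c : ℝ) {s : ℝ} (hs : 0 < s) :
    HasDerivAt (fun s => mittagLeffler α (c * s ^ α))
      (∑' n : ℕ, c ^ (n + 1) * s ^ (α * (n + 1) - 1) / Real.Gamma (α * (n + 1))) s := by
  have h := (hasDerivAt_mittagLeffler hα (c * s ^ α)).comp s
    ((Real.hasDerivAt_rpow_const (p := α) (Or.inl hs.ne')).const_mul c)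
  convert! h using 1
  rw [← tsum_mul_right]
  congr 1 with n
  have hG : 0 < Real.Gamma (α * (n + 1)) := Real.Gamma_pos_of_pos (by positivity)
  rw [Real.Gamma_add_one (by positivity), mul_pow, ← Real.rpow_mul_natCast hs.le,
    show α * ((n : ℝ) + 1) - 1 = α * n + (α - 1) by ring, Real.rpow_add hs]
  field_simp
  ring

/-! ### Beta integrals and the Caputo equation -/

theorem Real.intervalIntegrable_rpow_mul_sub_rpow {u v t : ℝ} (hu : 0 < u) (hv : 0 < v)
    (ht : 0 < t) :
    IntervalIntegrable (fun s : ℝ => s ^ (u - 1) * (t - s) ^ (v - 1)) volume 0 t := by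
  -- Each half of the interval has a single endpoint singularity; s ↦ t - s swaps the halves and
  -- exchanges u and v.
  have left {u v : ℝ} (hu : 0 < u) :
      IntervalIntegrable (fun s : ℝ => s ^ (u - 1) * (t - s) ^ (v - 1)) volume 0 (t / 2) := by
    refine (intervalIntegral.intervalIntegrable_rpow' (by linarith)).mul_continuousOn ?_
    refine ContinuousOn.rpow_const (by fun_prop) fun s hs => Or.inl ?_
    rw [uIcc_of_le (by linarith)] at hs
    linarith [hs.2]
  refine (left hu).trans ?_
  have := ((left (u := v) (v := u) hv).comp_sub_left t).symm
  simp only [sub_sub_cancel, sub_zero] at this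
  rw [show t - t / 2 = t / 2 by ring] at this
  simpa only [mul_comm] using this

theorem Real.integral_rpow_mul_sub_rpow {u v t : ℝ} (hu : 0 < u) (hv : 0 < v) (ht : 0 < t) :
    ∫ s in 0..t, s ^ (u - 1) * (t - s) ^ (v - 1) =
      t ^ (u + v - 1) * (Real.Gamma u * Real.Gamma v / Real.Gamma (u + v)) := by
  have h := Complex.betaIntegral_scaled (u : ℂ) v ht
  rw [Complex.betaIntegral_eq_Gamma_mul_div _ _ (by simpa) (by simpa), ← Complex.ofReal_add,
    Complex.Gamma_ofReal, Complex.Gamma_ofReal, Complex.Gamma_ofReal] at h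
  apply Complex.ofReal_injective
  rw [← intervalIntegral.integral_ofReal]
  convert! h using 1
  · refine intervalIntegral.integral_congr fun s hs => ?_
    rw [uIcc_of_le ht.le] at hs
    rw [Complex.ofReal_mul, Complex.ofReal_cpow hs.1, Complex.ofReal_cpow (by linarith [hs.2])]
    push_cast
    rfl
  · rw [Complex.ofReal_mul, Complex.ofReal_cpow ht.le]
    push_cast
    rfl

theorem integrable_tsum_of_summable_integral_norm {X ι : Type*} [MeasurableSpace X]
    {μ : Measure X} [Countable ι] {F : ι → X → ℝ} (hF : ∀ i, Integrable (F i) μ)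
    (hsum : Summable fun i => ∫ x, ‖F i x‖ ∂μ)
    (hmeas : AEStronglyMeasurable (fun x => ∑' i, F i x) μ) :
    Integrable (fun x => ∑' i, F i x) μ := by
  refine ⟨hmeas, ?_⟩
  calc ∫⁻ x, ‖∑' i, F i x‖ₑ ∂μ ≤ ∫⁻ x, ∑' i, ‖F i x‖ₑ ∂μ :=
        lintegral_mono fun x => enorm_tsum_le_tsum_enorm
    _ = ∑' i, ∫⁻ x, ‖F i x‖ₑ ∂μ := lintegral_tsum fun i => (hF i).1.enorm
    _ = ∑' i, ENNReal.ofReal (∫ x, ‖F i x‖ ∂μ) := by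
        congr 1 with i
        rw [ofReal_integral_norm_eq_lintegral_enorm (hF i)]
    _ < ⊤ := hsum.tsum_ofReal_lt_top

/-- The function `s ↦ E_α(c s^α)` solves the Caputo equation `D^α w = c w`. -/
theorem caputo_mittagLeffler {α : ℝ} (hα₀ : 0 < α) (hα₁ : α < 1) (c : ℝ) {t : ℝ} (ht : 0 < t) :
    IntervalIntegrable (fun s => (t - s) ^ (-α) * deriv (fun s => mittagLeffler α (c * s ^ α)) s)
      volume 0 t ∧
    ∫ s in 0..t, (t - s) ^ (-α) * deriv (fun s => mittagLeffler α (c * s ^ α)) s =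
      c * Real.Gamma (1 - α) * mittagLeffler α (c * t ^ α) := by
  -- The n-th term of the integrand, with -α written as (1-α)-1 to match the Beta integral.
  set F : ℕ → ℝ → ℝ := fun n s =>
    c ^ (n + 1) / Real.Gamma (α * (n + 1)) * (s ^ (α * (n + 1) - 1) * (t - s) ^ ((1 - α) - 1))
    with hF
  have hFint (n : ℕ) : IntegrableOn (F n) (Ioc 0 t) :=
    (intervalIntegrable_iff_integrableOn_Ioc_of_le ht.le).1
      ((Real.intervalIntegrable_rpow_mul_sub_rpow (by positivity) (by linarith) ht).const_mul _)
  have hbeta (n : ℕ) :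
      ∫ s in Ioc 0 t, s ^ (α * (n + 1) - 1) * (t - s) ^ ((1 - α) - 1) =
        Real.Gamma (α * (n + 1)) * (Real.Gamma (1 - α) * ((t ^ α) ^ n / Real.Gamma (α * n + 1))) := by
    rw [← intervalIntegral.integral_of_le ht.le,
      Real.integral_rpow_mul_sub_rpow (by positivity) (by linarith) ht,
      ← Real.rpow_mul_natCast ht.le]
    ring_nf
  have hG (n : ℕ) : 0 < Real.Gamma (α * (n + 1)) := Real.Gamma_pos_of_pos (by positivity)
  have hFval (n : ℕ) : ∫ s in Ioc 0 t, F n s =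
      c * Real.Gamma (1 - α) * ((c * t ^ α) ^ n / Real.Gamma (α * n + 1)) := by
    rw [hF, integral_const_mul, hbeta, mul_pow]
    have := (hG n).ne'
    field_simp
    ring
  have hFnorm (n : ℕ) : ∫ s in Ioc 0 t, ‖F n s‖ =
      |c| * Real.Gamma (1 - α) * ((|c| * t ^ α) ^ n / Real.Gamma (α * n + 1)) := by
    have : ∫ s in Ioc 0 t, ‖F n s‖ = ∫ s in Ioc 0 t, |c| ^ (n + 1) / Real.Gamma (α * (n + 1)) *
        (s ^ (α * (n + 1) - 1) * (t - s) ^ ((1 - α) - 1)) := by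
      refine setIntegral_congr_fun measurableSet_Ioc fun s hs => ?_
      have h1 := Real.rpow_nonneg hs.1.le (α * (n + 1) - 1)
      have h2 := Real.rpow_nonneg (sub_nonneg.2 hs.2) ((1 - α) - 1)
      rw [hF]
      simp only
      rw [norm_mul, Real.norm_of_nonneg (mul_nonneg h1 h2), norm_div, norm_pow,
        Real.norm_of_nonneg (hG n).le, Real.norm_eq_abs]
    rw [this, integral_const_mul, hbeta, mul_pow]
    have := (hG n).ne'
    field_simp
    ring
  -- The L¹ norms form the same series with |c| for c, which licenses exchanging sum and integral.
  have hsum : Summable fun n => ∫ s in Ioc 0 t, ‖F n s‖ := by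
    simp_rw [hFnorm]
    exact (Real.summable_pow_div_Gamma hα₀ _).mul_left _
  have heq : EqOn (fun s => ∑' n, F n s)
      (fun s => (t - s) ^ (-α) * deriv (fun s => mittagLeffler α (c * s ^ α)) s) (Ioc 0 t) := by
    intro s hs
    simp only [hF]
    rw [(hasDerivAt_mittagLeffler_rpow hα₀ c hs.1).deriv, ← tsum_mul_left]
    congr 1 with n
    rw [show 1 - α - 1 = -α by ring]
    ring
  constructor
  · rw [intervalIntegrable_iff_integrableOn_Ioc_of_le ht.le]
    have hmeas : Measurable fun s =>
        (t - s) ^ (-α) * deriv (fun s => mittagLeffler α (c * s ^ α)) s :=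
      (by fun_prop : Measurable fun s : ℝ => (t - s) ^ (-α)).mul (measurable_deriv _)
    refine IntegrableOn.congr_fun ?_ heq measurableSet_Ioc
    refine integrable_tsum_of_summable_integral_norm hFint hsum ?_
    refine hmeas.aestronglyMeasurable.congr ?_
    filter_upwards [ae_restrict_mem measurableSet_Ioc] with s hs using (heq hs).symm
  · rw [intervalIntegral.integral_of_le ht.le, ← setIntegral_congr_fun measurableSet_Ioc heq,
      ← integral_tsum_of_summable_integral_norm hFint hsum]
    simp_rw [hFval]
    rw [tsum_mul_left, mittagLeffler]

/-! ### Minimum principle for the Caputo derivative -/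

/-- At a minimum point the (unnormalized) Caputo derivative is bounded above by the increment from
the left endpoint. -/
theorem integral_rpow_mul_deriv_le_of_isMinOn {α t : ℝ} (hα₀ : 0 < α) (hα₁ : α < 1) (ht : 0 < t)
    {w w' : ℝ → ℝ} (hw : ContinuousOn w (Icc 0 t)) (hw' : ∀ s ∈ Ioc 0 t, HasDerivAt w (w' s) s)
    (hint : IntervalIntegrable (fun s => (t - s) ^ (-α) * w' s) volume 0 t)
    (hmin : ∀ s ∈ Icc 0 t, w t ≤ w s) :
    ∫ s in 0..t, (t - s) ^ (-α) * w' s ≤ -(t ^ (-α) * (w 0 - w t)) := by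
  -- Stop short of t, where the kernel is singular, and integrate by parts with w - w(t); the
  -- discarded integral of α(t-s)^(-α-1)(w(s) - w(t)) is nonnegative.
  have hbound : ∀ x ∈ Ioo 0 t, ∫ s in 0..x, (t - s) ^ (-α) * w' s ≤
      (t - x) ^ (-α) * (w x - w t) - t ^ (-α) * (w 0 - w t) := by
    intro x hx
    have hsub : uIcc 0 x ⊆ Icc 0 t := by
      rw [uIcc_of_le hx.1.le]; exact Icc_subset_Icc_right hx.2.le
    have hpos : ∀ s ∈ uIcc 0 x, 0 < t - s := by
      intro s hs
      rw [uIcc_of_le hx.1.le] at hs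
      linarith [hs.2, hx.2]
    have hcont (β : ℝ) : ContinuousOn (fun s => (t - s) ^ β) (uIcc 0 x) :=
      ContinuousOn.rpow_const (by fun_prop) fun s hs => Or.inl (hpos s hs).ne'
    have hmn : min 0 x = 0 := min_eq_left hx.1.le
    have hmx : max 0 x = x := max_eq_right hx.1.le
    have hint' : IntervalIntegrable w' volume 0 x := by
      have h1 := hint.mono_set (c := 0) (d := x) (by rwa [uIcc_of_le ht.le])
      refine (h1.continuousOn_mul (hcont α)).congr fun s hs => ?_
      have := hpos s (uIoc_subset_uIcc hs)
      rw [← mul_assoc, ← Real.rpow_add this, add_neg_cancel, Real.rpow_zero, one_mul]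
    rw [intervalIntegral.integral_mul_deriv_eq_deriv_mul_of_hasDerivAt
      (u := fun s => (t - s) ^ (-α)) (v := fun s => w s - w t)
      (u' := fun s => α * (t - s) ^ (-α - 1)) (v' := w') (hcont _)
      ((hw.mono hsub).sub continuousOn_const) ?_ ?_ ((hcont _).const_smul α).intervalIntegrable
      hint']
    · have : 0 ≤ ∫ s in 0..x, α * (t - s) ^ (-α - 1) * (w s - w t) := by
        refine intervalIntegral.integral_nonneg hx.1.le fun s hs => ?_
        rw [← uIcc_of_le hx.1.le] at hs
        have := (hpos s hs).le
        have := hmin s (hsub hs)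
        exact mul_nonneg (by positivity) (by linarith)
      rw [sub_zero]
      linarith
    · intro s hs
      rw [hmn, hmx] at hs
      have hs' := hpos s (uIcc_of_le hx.1.le ▸ Ioo_subset_Icc_self hs)
      convert! ((hasDerivAt_id s).const_sub t).rpow_const (p := -α) (Or.inl hs'.ne') using 1
      simp
    · intro s hs
      rw [hmn, hmx] at hs
      exact (hw' s ⟨hs.1, hs.2.le.trans hx.2.le⟩).sub_const _
  have hIoo : Ioo 0 t ∈ nhdsWithin t (Iio t) := Ioo_mem_nhdsLT ht
  have hL : Filter.Tendsto (fun x => ∫ s in 0..x, (t - s) ^ (-α) * w' s) (nhdsWithin t (Iio t))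
      (nhds (∫ s in 0..t, (t - s) ^ (-α) * w' s)) := by
    have hc := intervalIntegral.continuousOn_primitive_interval' hint (left_mem_uIcc)
    rw [uIcc_of_le ht.le] at hc
    exact (hc t (right_mem_Icc.2 ht.le)).mono_left
      (nhdsWithin_le_of_mem (Filter.mem_of_superset hIoo Ioo_subset_Icc_self))
  -- Differentiability at t gives w(x) - w(t) = O(t-x), so the boundary term is O((t-x)^(1-α)).
  have hR : Filter.Tendsto (fun x => (t - x) ^ (-α) * (w x - w t)) (nhdsWithin t (Iio t))
      (nhds 0) := by
    have hd : (fun x => w x - w t) =O[nhdsWithin t (Iio t)] fun x => x - t :=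
      (hw' t ⟨ht, le_rfl⟩).isBigO_sub.mono nhdsWithin_le_nhds
    have h1 : (fun x => (t - x) ^ (-α) * (w x - w t)) =O[nhdsWithin t (Iio t)]
        fun x => (t - x) ^ (-α) * (x - t) := (Asymptotics.isBigO_refl _ _).mul hd
    refine h1.trans_tendsto ?_
    have h2 : Filter.Tendsto (fun x : ℝ => -(t - x) ^ (1 - α)) (nhdsWithin t (Iio t)) (nhds 0) := by
      have : ContinuousAt (fun x : ℝ => -(t - x) ^ (1 - α)) t :=
        (ContinuousAt.rpow_const (by fun_prop) (Or.inr (by linarith))).neg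
      have h3 := this.tendsto
      simp only [sub_self, Real.zero_rpow (by linarith : 1 - α ≠ 0), neg_zero] at h3
      exact h3.mono_left nhdsWithin_le_nhds
    refine h2.congr' ?_
    filter_upwards [self_mem_nhdsWithin] with x hx
    have hx' : 0 < t - x := sub_pos.2 hx
    rw [sub_eq_add_neg 1 α, add_comm, Real.rpow_add_one hx'.ne']
    ring
  have := le_of_tendsto_of_tendsto hL (hR.sub_const (t ^ (-α) * (w 0 - w t)))
    (Filter.mem_of_superset hIoo hbound)
  linarith

theorem continuous_mittagLeffler_rpow {α : ℝ} (hα : 0 < α) (c : ℝ) :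
    Continuous fun s : ℝ => mittagLeffler α (c * s ^ α) :=
  (continuous_mittagLeffler hα).comp (continuous_const.mul (Real.continuous_rpow_const hα.le))

/-- The weak maximum principle for combinations `s ↦ E_α(c s^α) + k E_α(d s^α)`. -/
theorem mittagLeffler_caputo_le_of_isMinOn {α : ℝ} (hα₀ : 0 < α) (hα₁ : α < 1) (c d k : ℝ) {t : ℝ}
    (ht : 0 < t)
    (hmin : ∀ s ∈ Icc 0 t, mittagLeffler α (c * t ^ α) + k * mittagLeffler α (d * t ^ α) ≤
      mittagLeffler α (c * s ^ α) + k * mittagLeffler α (d * s ^ α)) :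
    Real.Gamma (1 - α) *
        (c * mittagLeffler α (c * t ^ α) + k * (d * mittagLeffler α (d * t ^ α))) ≤
      -(t ^ (-α) *
        (1 + k - (mittagLeffler α (c * t ^ α) + k * mittagLeffler α (d * t ^ α)))) := by
  obtain ⟨hic, hc⟩ := caputo_mittagLeffler hα₀ hα₁ c ht
  obtain ⟨hid, hd⟩ := caputo_mittagLeffler hα₀ hα₁ d ht
  have hder (c : ℝ) : ∀ s ∈ Ioc 0 t, HasDerivAt (fun s => mittagLeffler α (c * s ^ α))
      (deriv (fun s => mittagLeffler α (c * s ^ α)) s) s := fun s hs =>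
    (hasDerivAt_mittagLeffler_rpow hα₀ c hs.1).differentiableAt.hasDerivAt
  have hi := hic.add (hid.const_mul k)
  have hfun : (fun s => (t - s) ^ (-α) * (deriv (fun s => mittagLeffler α (c * s ^ α)) s +
      k * deriv (fun s => mittagLeffler α (d * s ^ α)) s)) = fun s =>
      (t - s) ^ (-α) * deriv (fun s => mittagLeffler α (c * s ^ α)) s +
      k * ((t - s) ^ (-α) * deriv (fun s => mittagLeffler α (d * s ^ α)) s) := by
    ext s; ring
  have key := integral_rpow_mul_deriv_le_of_isMinOn hα₀ hα₁ ht
    (w := fun s => mittagLeffler α (c * s ^ α) + k * mittagLeffler α (d * s ^ α))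
    (w' := fun s => deriv (fun s => mittagLeffler α (c * s ^ α)) s +
      k * deriv (fun s => mittagLeffler α (d * s ^ α)) s)
    ((continuous_mittagLeffler_rpow hα₀ c).add
      ((continuous_mittagLeffler_rpow hα₀ d).const_smul k)).continuousOn
    (fun s hs => (hder c s hs).add ((hder d s hs).const_mul k)) (by rw [hfun]; exact hi) hmin
  rw [hfun, intervalIntegral.integral_add hic (hid.const_mul k),
    intervalIntegral.integral_const_mul, hc, hd] at key
  simp only [Real.zero_rpow hα₀.ne', mul_zero, mittagLeffler_zero, mul_one] at key
  linarith

/-! ### Sign and monotonicity of E_α on the nonpositive half-line -/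

/-- At a negative minimum of w(s) = E_α(x s^α) on [0, 1], x·w(t) ≥ 0, whereas the minimum principle
bounds Γ(1-α)·x·w(t) by a negative number, as w(0) = 1. -/
theorem mittagLeffler_nonneg_of_nonpos {α : ℝ} (hα₀ : 0 < α) (hα₁ : α < 1) {x : ℝ} (hx : x ≤ 0) :
    0 ≤ mittagLeffler α x := by
  by_contra! hneg
  obtain ⟨t, htm, hmin⟩ := isCompact_Icc.exists_isMinOn (nonempty_Icc.2 (zero_le_one' ℝ))
    (continuous_mittagLeffler_rpow hα₀ x).continuousOn
  have ht1 : mittagLeffler α (x * t ^ α) ≤ mittagLeffler α (x * 1 ^ α) :=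
    hmin (right_mem_Icc.2 zero_le_one)
  rw [Real.one_rpow, mul_one] at ht1
  have ht0 : 0 < t := by
    refine htm.1.lt_of_ne fun h => ?_
    rw [← h, Real.zero_rpow hα₀.ne', mul_zero, mittagLeffler_zero] at ht1
    linarith
  have key := mittagLeffler_caputo_le_of_isMinOn hα₀ hα₁ x 0 0 ht0 fun s hs => by
    simpa using hmin ⟨hs.1, hs.2.trans htm.2⟩
  simp only [zero_mul, add_zero] at key
  have hG := Real.Gamma_pos_of_pos (sub_pos.2 hα₁)
  have hp := Real.rpow_pos_of_pos ht0 (-α)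
  have h1 := mul_nonneg hG.le (mul_nonneg_of_nonpos_of_nonpos hx (ht1.trans hneg.le))
  have h2 := mul_pos hp (show 0 < 1 - mittagLeffler α (x * t ^ α) by linarith)
  linarith

/-- A zero at x would make s = 1 a minimum point of E_α(x s^α), and the minimum principle would read
0 ≤ -1. -/
theorem mittagLeffler_pos_of_nonpos {α : ℝ} (hα₀ : 0 < α) (hα₁ : α < 1) {x : ℝ} (hx : x ≤ 0) :
    0 < mittagLeffler α x := by
  refine (mittagLeffler_nonneg_of_nonpos hα₀ hα₁ hx).lt_of_ne fun h => ?_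
  have key := mittagLeffler_caputo_le_of_isMinOn hα₀ hα₁ x 0 0 one_pos fun s hs => by
    simpa [← h] using mittagLeffler_nonneg_of_nonpos hα₀ hα₁
      (mul_nonpos_of_nonpos_of_nonneg hx (Real.rpow_nonneg hs.1 α))
  simp [← h] at key
  linarith

/-- The minimum principle is applied to E_α(y s^α) - E_α(x s^α), which starts at 0, at a negative
minimum. -/
theorem mittagLeffler_monotoneOn {α : ℝ} (hα₀ : 0 < α) (hα₁ : α < 1) :
    MonotoneOn (mittagLeffler α) (Iic 0) := by
  intro x hx y hy hxy
  by_contra! hneg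
  rw [mem_Iic] at hx hy
  obtain ⟨t, htm, hmin⟩ := isCompact_Icc.exists_isMinOn (nonempty_Icc.2 (zero_le_one' ℝ))
    ((continuous_mittagLeffler_rpow hα₀ y).add
      ((continuous_mittagLeffler_rpow hα₀ x).const_smul (-1 : ℝ))).continuousOn
  have hmin' (s : ℝ) (hs : s ∈ Icc 0 1) : mittagLeffler α (y * t ^ α) +
      (-1) * mittagLeffler α (x * t ^ α) ≤
      mittagLeffler α (y * s ^ α) + (-1) * mittagLeffler α (x * s ^ α) := hmin hs
  have ht1 := hmin' 1 (right_mem_Icc.2 zero_le_one)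
  rw [Real.one_rpow, mul_one, mul_one] at ht1
  have ht0 : 0 < t := by
    refine htm.1.lt_of_ne fun h => ?_
    rw [← h, Real.zero_rpow hα₀.ne', mul_zero, mul_zero, mittagLeffler_zero] at ht1
    linarith
  have key := mittagLeffler_caputo_le_of_isMinOn hα₀ hα₁ y x (-1) ht0 fun s hs =>
    hmin' s ⟨hs.1, hs.2.trans htm.2⟩
  have hG := Real.Gamma_pos_of_pos (sub_pos.2 hα₁)
  have hp := Real.rpow_pos_of_pos ht0 (-α)
  have hE := mittagLeffler_nonneg_of_nonpos hα₀ hα₁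
    (mul_nonpos_of_nonpos_of_nonneg hx (Real.rpow_nonneg ht0.le α))
  set e := mittagLeffler α (y * t ^ α)
  set f := mittagLeffler α (x * t ^ α)
  have hef : e - f < 0 := by linarith
  -- ye - xf = y(e-f) + (y-x)f, a sum of two nonnegative terms.
  have h1 : 0 ≤ y * e + (-1) * (x * f) := by nlinarith
  have h2 := mul_nonneg hG.le h1
  have h3 := mul_pos hp (show 0 < 1 + -1 - (e + (-1) * f) by linarith)
  linarith

/-! ### Integration by parts at a minimum of the primitive -/

/-- Integrating against a nonnegative kernel with nonnegative derivative, when the primitive of the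
integrand is smallest at the right endpoint. -/
theorem integral_mul_le_of_primitive_ge {a t : ℝ} (hat : a ≤ t) {K K' g : ℝ → ℝ}
    (hK : ContinuousOn K (Icc a t)) (hK' : ∀ s ∈ Ioo a t, HasDerivAt K (K' s) s)
    (hK'_nonneg : ∀ s ∈ Ioo a t, 0 ≤ K' s) (hg : IntervalIntegrable g volume a t)
    (hmin : ∀ x ∈ Icc a t, ∫ s in a..t, g s ≤ ∫ s in a..x, g s) :
    ∫ s in a..t, K s * g s ≤ K a * ∫ s in a..t, g s := by
  -- Continuity of K and the sign of K' force integrability, even if K' blows up at an endpoint.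
  have hint : IntervalIntegrable K' volume a t :=
    intervalIntegral.intervalIntegrable_deriv_of_nonneg (by rwa [uIcc_of_le hat])
      (by simpa [hat] using hK') (by simpa [hat] using hK'_nonneg)
  have hKeq : ∀ x ∈ Icc a t, (∫ s in a..x, K' s) - -K a = K x := by
    intro x hx
    have hsub : Icc a x ⊆ Icc a t := Icc_subset_Icc_right hx.2
    rw [intervalIntegral.integral_eq_sub_of_hasDeriv_right_of_le hx.1 (hK.mono hsub)
      (fun s hs => (hK' s ⟨hs.1, hs.2.trans_le hx.2⟩).hasDerivWithinAt)
      (hint.mono_set (by rwa [uIcc_of_le hat, uIcc_of_le hx.1]))]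
    ring
  have hconst (c : ℝ) : AbsolutelyContinuousOnInterval (fun _ => c) a t :=
    (LipschitzWith.const c).lipschitzOnWith.absolutelyContinuousOnInterval
  have hAC {h : ℝ → ℝ} (hh : IntervalIntegrable h volume a t) (c : ℝ) :
      AbsolutelyContinuousOnInterval (fun x => (∫ s in a..x, h s) - c) a t :=
    (hh.absolutelyContinuousOnInterval_intervalIntegral left_mem_uIcc).sub (hconst c)
  -- The constants make the first factor equal to K and the second vanish at t, so only the boundary
  -- term at a survives.
  have key := (hAC hint (-K a)).integral_mul_deriv_eq_deriv_mul (hAC hg (∫ s in a..t, g s))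
  have hderiv {h : ℝ → ℝ} (hh : IntervalIntegrable h volume a t) (c : ℝ) :
      ∀ᵐ x, x ∈ uIoc a t → deriv (fun x => (∫ s in a..x, h s) - c) x = h x := by
    filter_upwards [hh.ae_hasDerivAt_integral] with x hx hxt
    exact ((hx (uIoc_subset_uIcc hxt) a left_mem_uIcc).sub_const c).deriv
  have hL : ∫ x in a..t, ((∫ s in a..x, K' s) - -K a) *
      deriv (fun x => (∫ s in a..x, g s) - ∫ s in a..t, g s) x = ∫ s in a..t, K s * g s := by
    refine intervalIntegral.integral_congr_ae ?_
    filter_upwards [hderiv hg (∫ s in a..t, g s)] with x hx hxt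
    rw [hx hxt, hKeq x (by rw [← uIcc_of_le hat]; exact uIoc_subset_uIcc hxt)]
  have hR : 0 ≤ ∫ x in a..t, deriv (fun x => (∫ s in a..x, K' s) - -K a) x *
      ((∫ s in a..x, g s) - ∫ s in a..t, g s) := by
    refine intervalIntegral.integral_nonneg_of_ae_restrict hat ?_
    rw [Filter.EventuallyLE, ae_restrict_iff' measurableSet_Icc]
    have hne : ∀ᵐ x : ℝ, x ≠ a ∧ x ≠ t := by
      have h1 : ∀ᵐ x : ℝ, x ≠ a := by simp [ae_iff, measure_singleton]
      have h2 : ∀ᵐ x : ℝ, x ≠ t := by simp [ae_iff, measure_singleton]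
      exact h1.and h2
    filter_upwards [hderiv hint (-K a), hne] with x hx hxne hxt
    have hxo : x ∈ Ioo a t := ⟨hxt.1.lt_of_ne hxne.1.symm, hxt.2.lt_of_ne hxne.2⟩
    rw [hx (by rw [uIoc_of_le hat]; exact Ioo_subset_Ioc_self hxo)]
    exact mul_nonneg (hK'_nonneg x hxo) (sub_nonneg.2 (hmin x hxt))
  rw [hL] at key
  simp only [intervalIntegral.integral_same, sub_self, mul_zero] at key
  linarith

/-! ### Weak derivatives and primitives -/

theorem HasCompactSupport.exists_tsupport_subset_Icc {φ : ℝ → ℝ} {a b : ℝ} (hab : a < b)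
    (hc : HasCompactSupport φ) (hs : tsupport φ ⊆ Ioo a b) :
    ∃ c d, a < c ∧ c ≤ d ∧ d < b ∧ tsupport φ ⊆ Icc c d := by
  rcases (tsupport φ).eq_empty_or_nonempty with h | h
  · exact ⟨(a + b) / 2, (a + b) / 2, by linarith, le_rfl, by linarith, by simp [h]⟩
  · obtain ⟨c, hcm, hcmin⟩ := hc.isCompact.exists_isLeast h
    obtain ⟨d, hdm, hdmax⟩ := hc.isCompact.exists_isGreatest h
    exact ⟨c, d, (hs hcm).1, hcmin hdm, (hs hdm).2, fun x hx => ⟨hcmin hx, hdmax hx⟩⟩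

/-- A test function on `(a, b)` with integral zero is the derivative of a test function. -/
theorem exists_deriv_eq_of_integral_eq_zero {ψ : ℝ → ℝ} {a b : ℝ} (hab : a < b)
    (hψ : ContDiff ℝ ∞ ψ) (hc : HasCompactSupport ψ) (hs : tsupport ψ ⊆ Ioo a b)
    (h0 : ∫ x in a..b, ψ x = 0) :
    ∃ φ : ℝ → ℝ, ContDiff ℝ ∞ φ ∧ HasCompactSupport φ ∧ tsupport φ ⊆ Ioo a b ∧
      deriv φ = ψ := by
  obtain ⟨c, d, hac, hcd, hdb, hsub⟩ := hc.exists_tsupport_subset_Icc hab hs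
  have hzero : ∀ x, x ∉ Icc c d → ψ x = 0 := fun x hx =>
    image_eq_zero_of_notMem_tsupport fun h => hx (hsub h)
  have hi (x y : ℝ) : IntervalIntegrable ψ volume x y := hψ.continuous.intervalIntegrable x y
  have hd (x : ℝ) : HasDerivAt (fun x => ∫ s in a..x, ψ s) (ψ x) x :=
    intervalIntegral.integral_hasDerivAt_right (hi a x)
      (hψ.continuous.stronglyMeasurableAtFilter _ _) hψ.continuous.continuousAt
  have hderiv : deriv (fun x => ∫ s in a..x, ψ s) = ψ := funext fun x => (hd x).deriv
  have hφ0 : ∀ x, x ∉ Icc c d → ∫ s in a..x, ψ s = 0 := by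
    intro x hx
    have hz : ∀ {y z : ℝ}, (∀ s ∈ uIcc y z, s < c ∨ d < s ∨ s ∉ Icc c d) →
        ∫ s in y..z, ψ s = 0 := by
      intro y z h
      rw [intervalIntegral.integral_congr (g := fun _ => (0 : ℝ))]
      · simp
      · intro s hs
        refine hzero s fun hsI => ?_
        rcases h s hs with h | h | h
        · exact absurd hsI.1 (not_le.2 h)
        · exact absurd hsI.2 (not_le.2 h)
        · exact h hsI
    rw [mem_Icc, not_and_or, not_le, not_le] at hx
    rcases hx with hx | hx
    · exact hz fun s hs => Or.inl (hs.2.trans_lt (max_lt hac hx))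
    -- Right of the support, the primitive equals the total integral, which is zero.
    · have := intervalIntegral.integral_add_adjacent_intervals (hi a x) (hi x b)
      rw [h0, hz fun s hs => Or.inr (Or.inl ((lt_min hx hdb).trans_le hs.1)), add_zero] at this
      exact this
  have hts : tsupport (fun x => ∫ s in a..x, ψ s) ⊆ Icc c d :=
    closure_minimal (fun x hx => by_contra fun h => hx (hφ0 x h)) isClosed_Icc
  refine ⟨fun x => ∫ s in a..x, ψ s, ?_, ?_, ?_, hderiv⟩
  · rw [contDiff_infty_iff_deriv, hderiv]
    exact ⟨fun x => (hd x).differentiableAt, hψ⟩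
  · exact HasCompactSupport.of_support_subset_isCompact isCompact_Icc
      ((subset_tsupport _).trans hts)
  · exact hts.trans (Icc_subset_Ioo hac hdb)

/-- A continuous function on `[a, b]` with vanishing weak derivative on `(a, b)` is constant. -/
theorem IsWeakDeriv.eq_const_of_zero {a b : ℝ} (hab : a < b) {h : ℝ → ℝ}
    (hh : ContinuousOn h (Icc a b)) (hw : IsWeakDeriv a b h 0) : ∃ C, ∀ x ∈ Icc a b, h x = C := by
  have hhi : IntegrableOn h (Ioo a b) :=
    (hh.integrableOn_Icc).mono_set Ioo_subset_Icc_self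
  obtain ⟨η₀, hη₀s, hη₀c, hη₀d, hη₀r, hη₀1⟩ := exists_contDiff_tsupport_subset (n := ⊤)
    (Ioo_mem_nhds (show a < (a + b) / 2 by linarith) (show (a + b) / 2 < b by linarith))
  have hmulint {φ : ℝ → ℝ} (hφ : Continuous φ) : IntegrableOn (fun x => h x * φ x) (Ioo a b) :=
    ((hh.mul hφ.continuousOn).integrableOn_Icc).mono_set Ioo_subset_Icc_self
  have hφint {φ : ℝ → ℝ} (hφ : Continuous φ) : IntegrableOn φ (Ioo a b) :=
    (hφ.continuousOn.integrableOn_Icc).mono_set Ioo_subset_Icc_self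
  have hI : 0 < ∫ x in a..b, η₀ x := by
    refine intervalIntegral.integral_pos hab hη₀d.continuous.continuousOn
      (fun x _ => (hη₀r ⟨x, rfl⟩).1) ⟨(a + b) / 2, ⟨by linarith, by linarith⟩, ?_⟩
    rw [hη₀1]; exact one_pos
  set I := ∫ x in a..b, η₀ x
  -- C is the η₀-weighted mean of h. Subtracting (J/I)η₀ from a test function ψ leaves integral
  -- zero, hence a derivative of a test function, on which h integrates to 0.
  set C := (∫ x in Ioo a b, h x * η₀ x) / I with hC
  refine ⟨C, ?_⟩
  have key : ∀ᵐ x, x ∈ Ioo a b → h x - C = 0 := by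
    refine isOpen_Ioo.ae_eq_zero_of_integral_contDiff_smul_eq_zero
      (hhi.sub (integrableOn_const (by simp))).locallyIntegrableOn ?_
    intro ψ hψ hψc hψs
    set J := ∫ x in a..b, ψ x with hJ
    have hs1 : tsupport (fun x => J / I * η₀ x) ⊆ tsupport η₀ := tsupport_mul_subset_right
    have hcd : ContDiff ℝ ∞ fun x => ψ x - J / I * η₀ x := hψ.sub (contDiff_const.mul hη₀d)
    have hcs : HasCompactSupport fun x => ψ x - J / I * η₀ x := hψc.sub hη₀c.mul_left
    have hts : tsupport (fun x => ψ x - J / I * η₀ x) ⊆ Ioo a b :=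
      (tsupport_sub _ _).trans (union_subset hψs (hs1.trans hη₀s))
    obtain ⟨φ, hφ, hφc, hφs, hφd⟩ := exists_deriv_eq_of_integral_eq_zero hab hcd hcs hts (by
      rw [intervalIntegral.integral_sub (hψ.continuous.intervalIntegrable _ _)
        ((hη₀d.continuous.intervalIntegrable _ _).const_mul _),
        intervalIntegral.integral_const_mul, div_mul_cancel₀ _ hI.ne', sub_self])
    have h1 := hw φ hφ hφc hφs
    rw [hφd] at h1
    simp only [Pi.zero_apply, zero_mul, integral_zero, neg_zero] at h1
    have h2 : ∫ x in Ioo a b, h x * (ψ x - J / I * η₀ x) =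
        (∫ x in Ioo a b, h x * ψ x) - J / I * ∫ x in Ioo a b, h x * η₀ x := by
      rw [← integral_const_mul, ← integral_sub (hmulint hψ.continuous)
        ((hmulint hη₀d.continuous).const_mul _)]
      congr 1 with x
      ring
    have h3 : ∫ x, ψ x • (h x - C) = ∫ x in Ioo a b, (h x * ψ x - C * ψ x) := by
      rw [← setIntegral_eq_integral_of_forall_compl_eq_zero (s := Ioo a b)]
      · congr 1 with x
        rw [smul_eq_mul]; ring
      · intro x hx
        have : ψ x = 0 := image_eq_zero_of_notMem_tsupport fun h => hx (hψs h)
        simp [this]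
    rw [h3, integral_sub (hmulint hψ.continuous) ((hφint hψ.continuous).const_mul _),
      integral_const_mul, ← integral_Ioc_eq_integral_Ioo (f := ψ),
      ← intervalIntegral.integral_of_le hab.le, ← hJ, hC]
    rw [h2] at h1
    rw [← h1]
    ring
  -- Continuity upgrades almost everywhere on (a, b) to everywhere on [a, b].
  have heq := Measure.eqOn_of_ae_eq (μ := volume) (s := Icc a b) (f := h) (g := fun _ => C) ?_ hh
    continuousOn_const (by rw [interior_Icc, closure_Ioo hab.ne])
  · exact heq
  · rw [← restrict_Ioo_eq_restrict_Icc, Filter.EventuallyEq, ae_restrict_iff' measurableSet_Ioo]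
    filter_upwards [key] with x hx hxI using sub_eq_zero.1 (hx hxI)

/-- A continuous function is a primitive of its integrable weak derivative. -/
theorem IsWeakDeriv.eq_add_integral {a b : ℝ} (hab : a < b) {f g : ℝ → ℝ}
    (hf : ContinuousOn f (Icc a b)) (hg : IntervalIntegrable g volume a b)
    (hw : IsWeakDeriv a b f g) : ∀ x ∈ Icc a b, f x = f a + ∫ s in a..x, g s := by
  have hG : ContinuousOn (fun x => ∫ s in a..x, g s) (Icc a b) := by
    have := intervalIntegral.continuousOn_primitive_interval' hg left_mem_uIcc
    rwa [uIcc_of_le hab.le] at this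
  -- Integration by parts shows that f minus the primitive of g has weak derivative zero.
  obtain ⟨C, hC⟩ := IsWeakDeriv.eq_const_of_zero hab (hf.sub hG) (by
    intro φ hφ hφc hφs
    have hd : Continuous (deriv φ) := (hφ.of_le (by simp)).continuous_deriv_one
    have hzero : ∀ x, x ∉ Ioo a b → φ x = 0 := fun x hx =>
      image_eq_zero_of_notMem_tsupport fun h => hx (hφs h)
    have hAC : AbsolutelyContinuousOnInterval φ a b :=
      (hφ.of_le (by simp)).contDiffOn.absolutelyContinuousOnInterval
    have hparts := (hg.absolutelyContinuousOnInterval_intervalIntegral (c := a)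
      left_mem_uIcc).integral_mul_deriv_eq_deriv_mul hAC
    have hcongr : ∫ x in a..b, deriv (fun x => ∫ s in a..x, g s) x * φ x =
        ∫ x in a..b, g x * φ x := by
      refine intervalIntegral.integral_congr_ae ?_
      filter_upwards [hg.ae_hasDerivAt_integral] with x hx hxt
      rw [(hx (uIoc_subset_uIcc hxt) a left_mem_uIcc).deriv]
    rw [hzero b (by simp), hzero a (by simp), mul_zero, mul_zero, sub_zero, zero_sub, hcongr,
      intervalIntegral.integral_of_le hab.le, intervalIntegral.integral_of_le hab.le,
      integral_Ioc_eq_integral_Ioo, integral_Ioc_eq_integral_Ioo, ← hw φ hφ hφc hφs] at hparts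
    have h1 : IntegrableOn (fun x => f x * deriv φ x) (Ioo a b) :=
      ((hf.mul hd.continuousOn).integrableOn_Icc).mono_set Ioo_subset_Icc_self
    have h2 : IntegrableOn (fun x => (∫ s in a..x, g s) * deriv φ x) (Ioo a b) :=
      ((hG.mul hd.continuousOn).integrableOn_Icc).mono_set Ioo_subset_Icc_self
    simp only [Pi.sub_apply, sub_mul, Pi.zero_apply, zero_mul, integral_zero, neg_zero]
    rw [integral_sub h1 h2, hparts, sub_self])
  intro x hx
  have h1 := hC x hx
  have h2 := hC a (left_mem_Icc.2 hab.le)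
  simp only [Pi.sub_apply, intervalIntegral.integral_same, sub_zero] at h1 h2
  linarith

theorem MemH1.intervalIntegrable_weakDeriv {a b : ℝ} (hab : a < b) {u : ℝ → ℝ}
    (hu : MemH1 a b u) : IntervalIntegrable (weakDeriv a b u) volume a b := by
  rw [intervalIntegrable_iff_integrableOn_Ioo_of_le hab.le]
  exact hu.weakDeriv_spec.1.integrable (by norm_num)

theorem MemH1.eq_add_integral_weakDeriv {a b : ℝ} (hab : a < b) {u : ℝ → ℝ} (hu : MemH1 a b u)
    (hc : ContinuousOn u (Icc a b)) :
    ∀ x ∈ Icc a b, u x = u a + ∫ s in a..x, weakDeriv a b u s :=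
  hu.weakDeriv_spec.2.eq_add_integral hab hc (hu.intervalIntegrable_weakDeriv hab)

/-! ### The Mittag-Leffler kernel -/

section MittagLefflerKernel

variable {α l : ℝ}

theorem continuous_mittagLeffler_kernel (hα₀ : 0 < α) (l t : ℝ) :
    Continuous fun s : ℝ => mittagLeffler α (-l * (t - s) ^ α) :=
  (continuous_mittagLeffler_rpow hα₀ (-l)).comp (continuous_const.sub continuous_id)

theorem mittagLeffler_kernel_arg_nonpos (hl : 0 ≤ l) {s t : ℝ} (hst : s ≤ t) :
    -l * (t - s) ^ α ≤ 0 :=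
  mul_nonpos_of_nonpos_of_nonneg (neg_nonpos.2 hl) (Real.rpow_nonneg (sub_nonneg.2 hst) α)

theorem mittagLeffler_kernel_pos (hα₀ : 0 < α) (hα₁ : α < 1) (hl : 0 ≤ l) {s t : ℝ}
    (hst : s ≤ t) : 0 < mittagLeffler α (-l * (t - s) ^ α) :=
  mittagLeffler_pos_of_nonpos hα₀ hα₁ (mittagLeffler_kernel_arg_nonpos hl hst)

theorem mittagLeffler_kernel_le_one (hα₀ : 0 < α) (hα₁ : α < 1) (hl : 0 ≤ l) {s t : ℝ}
    (hst : s ≤ t) : mittagLeffler α (-l * (t - s) ^ α) ≤ 1 := by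
  have h := mittagLeffler_kernel_arg_nonpos (α := α) hl hst
  simpa [mittagLeffler_zero] using mittagLeffler_monotoneOn hα₀ hα₁ h (mem_Iic.2 le_rfl) h

theorem mittagLeffler_kernel_monotoneOn (hα₀ : 0 < α) (hα₁ : α < 1) (hl : 0 ≤ l) (t : ℝ) :
    MonotoneOn (fun s : ℝ => mittagLeffler α (-l * (t - s) ^ α)) (Iic t) := by
  intro x hx y hy hxy
  refine mittagLeffler_monotoneOn hα₀ hα₁ (mittagLeffler_kernel_arg_nonpos hl hx)
    (mittagLeffler_kernel_arg_nonpos hl hy) ?_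
  have := Real.rpow_le_rpow (sub_nonneg.2 hy) (sub_le_sub_left hxy t) hα₀.le
  nlinarith

/-- The maximum principle for the Caputo derivative with Mittag-Leffler kernel. -/
theorem integral_mittagLeffler_kernel_mul_le (hα₀ : 0 < α) (hα₁ : α < 1) (hl : 0 ≤ l) {a t : ℝ}
    (hat : a ≤ t) {g : ℝ → ℝ} (hg : IntervalIntegrable g volume a t)
    (hmin : ∀ x ∈ Icc a t, ∫ s in a..t, g s ≤ ∫ s in a..x, g s) :
    ∫ s in a..t, mittagLeffler α (-l * (t - s) ^ α) * g s ≤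
      mittagLeffler α (-l * (t - a) ^ α) * ∫ s in a..t, g s := by
  refine integral_mul_le_of_primitive_ge hat
    (K' := deriv fun s : ℝ => mittagLeffler α (-l * (t - s) ^ α))
    (continuous_mittagLeffler_kernel hα₀ l t).continuousOn (fun s hs => ?_) (fun s hs => ?_) hg hmin
  · have h1 := (hasDerivAt_mittagLeffler_rpow hα₀ (-l) (sub_pos.2 hs.2)).differentiableAt
    exact (h1.comp s (f := fun s => t - s) (by fun_prop)).hasDerivAt
  · rw [← derivWithin_of_isOpen isOpen_Iio hs.2]
    exact ((mittagLeffler_kernel_monotoneOn hα₀ hα₁ hl t).mono Iio_subset_Iic_self).derivWithin_nonneg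

/-- The kernel lies between 0 and 1, so the integral is at most ∫|g| over (a, t). This yields the
initial inequality v(a) ≥ 0. -/
theorem tendsto_integral_mittagLeffler_kernel_mul (hα₀ : 0 < α) (hα₁ : α < 1) (hl : 0 ≤ l)
    {a b : ℝ} (hab : a < b) {g : ℝ → ℝ} (hg : IntervalIntegrable g volume a b) :
    Filter.Tendsto (fun t => ∫ s in a..t, mittagLeffler α (-l * (t - s) ^ α) * g s)
      (nhdsWithin a (Ioc a b)) (nhds 0) := by
  have hcont := intervalIntegral.continuousOn_primitive_interval' hg.norm left_mem_uIcc
  rw [uIcc_of_le hab.le] at hcont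
  have h0 := (hcont a (left_mem_Icc.2 hab.le)).mono_left (nhdsWithin_mono a Ioc_subset_Icc_self)
  simp only [intervalIntegral.integral_same] at h0
  refine squeeze_zero_norm' ?_ h0
  filter_upwards [self_mem_nhdsWithin] with t ht
  have hgt : IntervalIntegrable g volume a t := hg.mono_set (by
    rw [uIcc_of_le hab.le, uIcc_of_le ht.1.le]; exact Icc_subset_Icc_right ht.2)
  refine intervalIntegral.norm_integral_le_of_norm_le ht.1.le ?_ hgt.norm
  refine Filter.Eventually.of_forall fun s hs => ?_
  rw [norm_mul, Real.norm_of_nonneg (mittagLeffler_kernel_pos hα₀ hα₁ hl hs.2).le]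
  exact mul_le_of_le_one_left (norm_nonneg _) (mittagLeffler_kernel_le_one hα₀ hα₁ hl hs.2)

end MittagLefflerKernel

/-! ### The comparison principle -/

theorem corollary3p2 (B : ℝ → ℝ) (hB : IsNormalizationFunction B)
    (a b α : ℝ) (hab : a < b) (hα₀ : 0 < α) (hα₁ : α < 1)
    (p g₁ g₂ u₁ u₂ : ℝ → ℝ)
    (hp : ContinuousOn p (Set.Icc a b)) (hp_nonneg : ∀ t ∈ Set.Icc a b, 0 ≤ p t)
    (hpa : p a ≠ 0)
    (hg₁ : ContinuousOn g₁ (Set.Icc a b)) (hg₂ : ContinuousOn g₂ (Set.Icc a b))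
    (hu₁ : MemH1 a b u₁) (hu₁_cont : ContinuousOn u₁ (Set.Icc a b))
    (hu₂ : MemH1 a b u₂) (hu₂_cont : ContinuousOn u₂ (Set.Icc a b))
    (h₁ : ∀ t ∈ Set.Ioc a b, abcDeriv B a b α u₁ t + p t * u₁ t = g₁ t)
    (h₂ : ∀ t ∈ Set.Ioc a b, abcDeriv B a b α u₂ t + p t * u₂ t = g₂ t)
    (hg : ∀ t ∈ Set.Icc a b, g₁ t ≤ g₂ t) :
    ∀ t ∈ Set.Icc a b, u₁ t ≤ u₂ t := by
  have hα' : 0 < 1 - α := sub_pos.2 hα₁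
  have hl : 0 ≤ α / (1 - α) := by positivity
  have hc : 0 < B α / (1 - α) := div_pos (hB.pos α ⟨hα₀.le, hα₁.le⟩) hα'
  have hi₁ := hu₁.intervalIntegrable_weakDeriv hab
  have hi₂ := hu₂.intervalIntegrable_weakDeriv hab
  have hi := hi₂.sub hi₁
  have haI : a ∈ Icc a b := left_mem_Icc.2 hab.le
  have hsub {t : ℝ} (ht : t ∈ Icc a b) : uIcc a t ⊆ uIcc a b := by
    rw [uIcc_of_le hab.le, uIcc_of_le ht.1]; exact Icc_subset_Icc_right ht.2
  set q : ℝ → ℝ := fun s => weakDeriv a b u₂ s - weakDeriv a b u₁ s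
  have hv : ∀ x ∈ Icc a b, u₂ x - u₁ x = (u₂ a - u₁ a) + ∫ s in a..x, q s := by
    intro x hx
    rw [hu₁.eq_add_integral_weakDeriv hab hu₁_cont x hx,
      hu₂.eq_add_integral_weakDeriv hab hu₂_cont x hx,
      intervalIntegral.integral_sub (hi₂.mono_set (hsub hx)) (hi₁.mono_set (hsub hx))]
    ring
  have heq : ∀ t ∈ Ioc a b,
      B α / (1 - α) * (∫ s in a..t, mittagLeffler α (-(α / (1 - α)) * (t - s) ^ α) * q s) =
        (g₂ t - g₁ t) - p t * (u₂ t - u₁ t) := by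
    intro t ht
    have htI := Ioc_subset_Icc_self ht
    have hk := (continuous_mittagLeffler_kernel hα₀ (α / (1 - α)) t).continuousOn (s := uIcc a t)
    have e : ∫ s in a..t, mittagLeffler α (-(α / (1 - α)) * (t - s) ^ α) * q s =
        (∫ s in a..t, mittagLeffler α (-(α / (1 - α)) * (t - s) ^ α) * weakDeriv a b u₂ s) -
        ∫ s in a..t, mittagLeffler α (-(α / (1 - α)) * (t - s) ^ α) * weakDeriv a b u₁ s := by
      rw [← intervalIntegral.integral_sub ((hi₂.mono_set (hsub htI)).continuousOn_mul hk)
        ((hi₁.mono_set (hsub htI)).continuousOn_mul hk)]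
      simp only [q, mul_sub]
    have e₁ := h₁ t ht
    have e₂ := h₂ t ht
    rw [abcDeriv] at e₁ e₂
    rw [e, ← e₁, ← e₂]
    ring
  -- The equation is only given for t > a; its limit at a has no memory term.
  have hva : 0 ≤ u₂ a - u₁ a := by
    have hlim := (tendsto_integral_mittagLeffler_kernel_mul hα₀ hα₁ hl hab hi).const_mul
      (B α / (1 - α))
    rw [mul_zero] at hlim
    have hlim' := (((hg₂.sub hg₁).sub (hp.mul (hu₂_cont.sub hu₁_cont))) a haI).mono_left
      (nhdsWithin_mono a (Ioc_subset_Icc_self (a := a) (b := b)))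
    have : (nhdsWithin a (Ioc a b)).NeBot := by
      rw [nhdsWithin_Ioc_eq_nhdsGT hab]; infer_instance
    have hz := tendsto_nhds_unique (hlim.congr' (by
      filter_upwards [self_mem_nhdsWithin] with t ht using heq t ht)) hlim'
    simp only [Pi.sub_apply, Pi.mul_apply] at hz
    have hpa' : 0 < p a := (hp_nonneg a haI).lt_of_ne' hpa
    refine nonneg_of_mul_nonneg_right (?_ : 0 ≤ p a * (u₂ a - u₁ a)) hpa'
    linarith [hg a haI]
  obtain ⟨t₀, ht₀, hmin⟩ := isCompact_Icc.exists_isMinOn ⟨a, haI⟩ (hu₂_cont.sub hu₁_cont)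
  have hmin' : ∀ x ∈ Icc a b, u₂ t₀ - u₁ t₀ ≤ u₂ x - u₁ x := fun x hx => hmin hx
  suffices h : 0 ≤ u₂ t₀ - u₁ t₀ from fun t ht => sub_nonneg.1 (h.trans (hmin' t ht))
  by_contra! hneg
  have hat : a < t₀ := ht₀.1.lt_of_ne fun h => by rw [← h] at hneg; linarith
  have hV := hv t₀ ht₀
  -- Minimality of v at t₀ is minimality of the primitive of q, which differs from v by the constant
  -- v(a).
  have key := integral_mittagLeffler_kernel_mul_le hα₀ hα₁ hl hat.le (hi.mono_set (hsub ht₀))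
    fun x hx => by
      have hx' : x ∈ Icc a b := ⟨hx.1, hx.2.trans ht₀.2⟩
      linarith [hmin' x hx', hv x hx']
  have hK := mittagLeffler_kernel_pos hα₀ hα₁ hl hat.le
  have hD : ∫ s in a..t₀, mittagLeffler α (-(α / (1 - α)) * (t₀ - s) ^ α) * q s < 0 :=
    key.trans_lt (mul_neg_of_pos_of_neg hK (by linarith))
  have h1 := heq t₀ ⟨hat, ht₀.2⟩
  have h2 := mul_neg_of_pos_of_neg hc hD
  have h3 := mul_nonpos_of_nonneg_of_nonpos (hp_nonneg t₀ ht₀) hneg.le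
  linarith [hg t₀ ht₀]
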